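/- A linear connection is called flat affine if its torsion and curvature vanish. For a manifold $M$ with a linear connection $\nabla$, let $\mathrm{Aff}(M,\nabla)$ be the set of diffeomorphisms $F$ of $M$ with $F_*(\nabla_XY)=\nabla_{F_*X}F_*Y$ for all smooth vector fields $X,Y$ on $M$. An infinitesimal affine transformation of $(M,\nabla)$ is a smooth vector field on $M$ whose local one-parameter groups consist of local affine transformations of $(M,\nabla)$, and $\mathrm{aff}(M,\nabla)$ denotes the set of complete infinitesimal affine transformations. Let $(G,\nabla^+)$ be a (finite-dimensional real) flat affine Lie group, i.e. $\nabla^+$ is a left invariant flat affine connection on the Lie group $G$. Let $H$ be a closed subgroup of $G$ such that $R_h\in\mathrm{Aff}(G,\nabla^+)$ for every $h\in H$, where $R_h(g)=gh$. Give $G/H$ its manifold structure for which the projection $\pi:G\to G/H$ is a smooth submersion. For $X$ in the Lie algebra $\mathfrak g$ of $G$ let $X^-$ be the right invariant vector field on $G$ determined by $X$, and $X^*=\pi_*X^-$. Let $\overline\nabla$ be the linear connection on $G/H$ determined by $\nabla^+$, that is, $$\overline\nabla_{X^*}Y^*=\pi_*\left(\nabla^+_{X^-}Y^-\right)\qquad\text{for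 all } X,Y\in\mathfrak g$$ (it is assumed that such a connection exists; it is then unique and $G$-invariant). Then for every $X\in\mathrm{aff}(G,\nabla^+)$ with $(R_h)_*X=X$ for all $h\in H$, the projected vector field $\pi_*X$ on $G/H$ is well defined and belongs to $\mathrm{aff}(G/H,\overline\nabla)$. In other words, $$\{\pi_*X \mid X\in\mathrm{aff}(G,\nabla^+),\ (R_h)_*X=X\ \text{for all } h\in H\}\subseteq \mathrm{aff}(G/H,\overline\nabla).$$ -/

import Mathlib

open scoped Manifold ContDiff

noncomputable section

section Manifolds

variable {E : Type*} [NormedAddCommGroup E] [NormedSpace ℝ E]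
  {M : Type*} [TopologicalSpace M] [ChartedSpace E M]
  {E' : Type*} [NormedAddCommGroup E'] [NormedSpace ℝ E']
  {N : Type*} [TopologicalSpace N] [ChartedSpace E' N]

variable (E M) in
/-- (Rough, i.e. not necessarily smooth) vector fields on a manifold `M` modelled on `E`. -/
abbrev VField : Type _ := Π x : M, TangentSpace 𝓘(ℝ, E) x

/-- The vector field `X` on `M` is smooth on the set `U`. -/
def VField.SmoothOn [IsManifold 𝓘(ℝ, E) ∞ M] (X : VField E M) (U : Set M) : Prop :=
  ContMDiffOn 𝓘(ℝ, E) 𝓘(ℝ, E).tangent ∞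
    (fun x : M => (⟨x, X x⟩ : TangentBundle 𝓘(ℝ, E) M)) U

/-- `X` is a smooth vector field on `M`, i.e. an element of `𝔛(M)`. -/
def VField.Smooth [IsManifold 𝓘(ℝ, E) ∞ M] (X : VField E M) : Prop :=
  ContMDiff 𝓘(ℝ, E) 𝓘(ℝ, E).tangent ∞
    (fun x : M => (⟨x, X x⟩ : TangentBundle 𝓘(ℝ, E) M))

/-- `X` and `X'` are `f`-related on `U`: `f_{*,p} X_p = X'_{f(p)}` for all `p ∈ U`.
If `f` is a diffeomorphism of `U` onto `f(U)`, this says that `X' = f_* X` on `f(U)`. -/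
def VField.RelatedOn (f : M → N) (X : VField E M) (X' : VField E' N) (U : Set M) : Prop :=
  ∀ p ∈ U, mfderiv 𝓘(ℝ, E) 𝓘(ℝ, E') f p (X p) = X' (f p)

/-- `X` and `X'` are `f`-related: `f_{*,p} X_p = X'_{f(p)}` for all `p`.
If `f` is a diffeomorphism, this says that `X' = f_* X`. -/
def VField.Related (f : M → N) (X : VField E M) (X' : VField E' N) : Prop :=
  ∀ p, mfderiv 𝓘(ℝ, E) 𝓘(ℝ, E') f p (X p) = X' (f p)

/-- `X` is complete: through every point passes an integral curve defined on all of `ℝ`. -/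
def VField.IsComplete (X : VField E M) : Prop :=
  ∀ p : M, ∃ γ : ℝ → M, γ 0 = p ∧ IsMIntegralCurve (I := 𝓘(ℝ, E)) γ X

variable (E M) in
/-- Linear connections on `M`: covariant derivatives on the tangent bundle of `M`. -/
abbrev LinearConnection [IsManifold 𝓘(ℝ, E) ∞ M] : Type _ :=
  CovariantDerivative 𝓘(ℝ, E) E (TangentSpace 𝓘(ℝ, E) : M → Type _)

namespace LinearConnection

variable [IsManifold 𝓘(ℝ, E) ∞ M]

/-- The vector field `∇_X Y`. -/
def nabla (D : LinearConnection E M) (X Y : VField E M) : VField E M :=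
  fun p => D Y p (X p)

/-- `∇` is a smooth connection. -/
def IsSmooth (D : LinearConnection E M) : Prop :=
  CovariantDerivative.ContMDiffCovariantDerivative D ∞

/-- The torsion tensor of `∇` vanishes. -/
def IsTorsionFree [FiniteDimensional ℝ E] (D : LinearConnection E M) : Prop :=
  haveI : CompleteSpace E := FiniteDimensional.complete ℝ E
  D.torsion = 0

/-- The curvature of `∇` vanishes: `∇_X ∇_Y Z - ∇_Y ∇_X Z - ∇_{[X, Y]} Z = 0`
for all smooth vector fields `X, Y, Z`. -/
def IsFlat (D : LinearConnection E M) : Prop :=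
  ∀ X Y Z : VField E M, X.Smooth → Y.Smooth → Z.Smooth →
    D.nabla X (D.nabla Y Z) - D.nabla Y (D.nabla X Z)
      - D.nabla (VectorField.mlieBracket 𝓘(ℝ, E) X Y) Z = 0

/-- `∇` is a flat affine connection. -/
def IsFlatAffine [FiniteDimensional ℝ E] (D : LinearConnection E M) : Prop :=
  D.IsSmooth ∧ D.IsTorsionFree ∧ D.IsFlat

/-- `F` belongs to `Aff(M, ∇)`: it is a diffeomorphism of `M` and
`F_* (∇_X Y) = ∇_{F_* X} F_* Y` for all smooth vector fields `X, Y` on `M`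
(here `X' = F_* X` and `Y' = F_* Y`). -/
def IsAffineTransformation (D : LinearConnection E M) (F : M → M) : Prop :=
  (∃ Φ : M ≃ₘ^∞⟮𝓘(ℝ, E), 𝓘(ℝ, E)⟯ M, ⇑Φ = F) ∧
  ∀ X Y X' Y' : VField E M, X.Smooth → Y.Smooth → X'.Smooth → Y'.Smooth →
    VField.Related F X X' → VField.Related F Y Y' →
      VField.Related F (D.nabla X Y) (D.nabla X' Y')

/-- `f` restricts to a local affine transformation defined on the open set `U`:
a diffeomorphism of `U` onto the open set `f(U)` with `f_* (∇_Y Z) = ∇_{f_* Y} f_* Z`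
for all smooth vector fields `Y, Z` on an open subset `V` of `U`
(here `Y' = f_* Y` and `Z' = f_* Z` on `f(V)`). -/
def IsLocalAffineTransformation (D : LinearConnection E M) (f : M → M) (U : Set M) : Prop :=
  IsLocalDiffeomorphOn 𝓘(ℝ, E) 𝓘(ℝ, E) ∞ f U ∧ Set.InjOn f U ∧
  ∀ V ⊆ U, IsOpen V → ∀ Y Z Y' Z' : VField E M,
    Y.SmoothOn V → Z.SmoothOn V → Y'.SmoothOn (f '' V) → Z'.SmoothOn (f '' V) →
    VField.RelatedOn f Y Y' V → VField.RelatedOn f Z Z' V →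
      VField.RelatedOn f (D.nabla Y Z) (D.nabla Y' Z') V

/-- `φ` is the local one-parameter group `φ_t : U → M`, `|t| < ε`, generated by `X` on the
open set `U`. -/
structure IsLocalOneParameterGroup (X : VField E M) (U : Set M) (ε : ℝ) (φ : ℝ → M → M) :
    Prop where
  isOpen : IsOpen U
  pos : 0 < ε
  smooth : ContMDiffOn (𝓘(ℝ, ℝ).prod 𝓘(ℝ, E)) 𝓘(ℝ, E) ∞ (fun q : ℝ × M => φ q.1 q.2)
    (Set.Ioo (-ε) ε ×ˢ U)
  initial : ∀ p ∈ U, φ 0 p = p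
  integralCurve : ∀ p ∈ U,
    IsMIntegralCurveOn (I := 𝓘(ℝ, E)) (fun t => φ t p) X (Set.Ioo (-ε) ε)

/-- `X ∈ 𝔞(M, ∇)`: `X` is a smooth vector field whose local one-parameter group around each
point consists of local affine transformations. (Around each point the local one-parameter group
exists, and its germ is unique, by the theory of ordinary differential equations.) -/
def IsInfinitesimalAffine (D : LinearConnection E M) (X : VField E M) : Prop :=
  X.Smooth ∧ ∀ p : M, ∃ (U : Set M) (ε : ℝ) (φ : ℝ → M → M), p ∈ U ∧
    IsLocalOneParameterGroup X U ε φ ∧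
    ∀ t ∈ Set.Ioo (-ε) ε, D.IsLocalAffineTransformation (φ t) U

/-- `aff(M, ∇)`: the complete infinitesimal affine transformations of `(M, ∇)`. -/
def aff (D : LinearConnection E M) : Set (VField E M) :=
  {X | D.IsInfinitesimalAffine X ∧ X.IsComplete}

end LinearConnection

end Manifolds

section LieGroups

variable {E : Type*} [NormedAddCommGroup E] [NormedSpace ℝ E]
  {G : Type*} [TopologicalSpace G] [ChartedSpace E G] [Group G]
  {E' : Type*} [NormedAddCommGroup E'] [NormedSpace ℝ E']

/-- `(G, ∇)` is a flat affine Lie group: `∇` is flat affine and left invariant. -/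
def LinearConnection.IsFlatAffineLieGroup [FiniteDimensional ℝ E] [LieGroup 𝓘(ℝ, E) ∞ G]
    (D : LinearConnection E G) : Prop :=
  D.IsFlatAffine ∧ ∀ g : G, D.IsAffineTransformation (fun x => g * x)

/-- The right invariant vector field `X⁻` on `G` with value `v` at the identity:
`X⁻_g = (R_g)_* v`. -/
def rightInvariantField (v : GroupLieAlgebra 𝓘(ℝ, E) G) : VField E G :=
  fun g => mfderiv 𝓘(ℝ, E) 𝓘(ℝ, E) (fun x : G => x * g) (1 : G) v

/-- The projection `π_* X` to `G/H` of a vector field `X` on `G` that is invariant under all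
`R_h`, `h ∈ H`: `(π_* X)_{gH} = π_{*,g} X_g`. For invariant `X` this does not depend on the
representative `g` of the coset; here a representative is chosen. -/
def projectField (H : Subgroup G) [ChartedSpace E' (G ⧸ H)] (X : VField E G) :
    VField E' (G ⧸ H) :=
  fun q => mfderiv 𝓘(ℝ, E) 𝓘(ℝ, E') (QuotientGroup.mk : G → G ⧸ H) q.out (X q.out)

/-- `∇'` is the connection on `G/H` determined by the connection `∇` on `G`:
`∇'_{X*} Y* = π_* (∇_{X⁻} Y⁻)` for all `X, Y` in the Lie algebra of `G`, where `X* = π_* X⁻`. -/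
def LinearConnection.IsDeterminedBy {H : Subgroup G} [ChartedSpace E' (G ⧸ H)]
    [IsManifold 𝓘(ℝ, E') ∞ (G ⧸ H)] (D' : LinearConnection E' (G ⧸ H))
    [LieGroup 𝓘(ℝ, E) ∞ G] (D : LinearConnection E G) : Prop :=
  ∀ v w : GroupLieAlgebra 𝓘(ℝ, E) G,
    D'.nabla (projectField H (rightInvariantField v)) (projectField H (rightInvariantField w))
      = projectField H (D.nabla (rightInvariantField v) (rightInvariantField w))

end LieGroups

end

/-! The local flow `φ` of an `R_h`-invariant field `X` commutes with right translation by `H`, by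
uniqueness of integral curves. Hence two points lie in one coset exactly when their images under `φ
t` do (`mk_eq_mk_iff`), and for a local section `σ` of `π` the maps `π ∘ φ t ∘ σ` are injective
local diffeomorphisms forming the local flow of `π_* X`. Completeness descends because `π` maps
integral curves to integral curves.

It remains to see that these maps are affine. The connection on `G/H` is prescribed only on the
fields `X*`, and the main point (`projectsAt_of_span`) is that covariant derivatives of arbitrary
`π`-related fields are `π`-related. Right invariant fields `s i` span every tangent space, but the
coefficients of a projectable field `B = ∑ b j • s j` need not be constant on fibres. So `B` is
rewritten as a combination of the `s i` with coefficients pulled back from the base, plus `∑ b j • T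
j` with `T j` vertical and of vertical covariant derivative; the Leibniz rule then allows arbitrary
coefficients `b j`.

Finally, fields on the base are lifted to `G`, pushed forward by the affine map `φ t`, and projected
again (`Projects.isLocalAffineTransformation`). -/

section

open Set Filter Topology

/-! ### Local sections of submersions -/

section LocalSections

variable {E : Type*} [NormedAddCommGroup E] [NormedSpace ℝ E]
  {M : Type*} [TopologicalSpace M] [ChartedSpace E M]
  {E' : Type*} [NormedAddCommGroup E'] [NormedSpace ℝ E']
  {N : Type*} [TopologicalSpace N] [ChartedSpace E' N]

/-- A submersion has a smooth local section through every point. -/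
theorem Manifold.IsSubmersionAt.exists_localSection {f : M → N} {x : M}
    (hf : Manifold.IsSubmersionAt 𝓘(ℝ, E) 𝓘(ℝ, E') ∞ f x) :
    ∃ (V : Set N) (σ : N → M), IsOpen V ∧ f x ∈ V ∧
      ContMDiffOn 𝓘(ℝ, E') 𝓘(ℝ, E) ∞ σ V ∧ σ (f x) = x ∧ ∀ y ∈ V, f (σ y) = y := by
  obtain ⟨F, _, _, h⟩ := hf
  set φ := h.domChart with hφ
  set ψ := h.codChart with hψ
  set e := h.equiv with he
  have hx : x ∈ φ.source := h.mem_domChart_source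
  have hfx : f x ∈ ψ.source := h.mem_codChart_source
  have hw : ∀ z ∈ φ.target, ψ (f (φ.symm z)) = (e z).1 := fun z hz => by
    have hz' : z ∈ (h.domChart.extend 𝓘(ℝ, E)).target := by simpa [hφ] using hz
    simpa [hφ, hψ, he] using h.writtenInCharts hz'
  -- In the charts `f` is the first projection of a product; the section freezes the second
  -- coordinate at its value for `x`.
  let τ : N → E := fun y => e.symm (ψ y, (e (φ x)).2)
  have hτs : ContMDiffOn 𝓘(ℝ, E') 𝓘(ℝ, E) ∞ τ ψ.source := by
    have h1 : ContMDiffOn 𝓘(ℝ, E') 𝓘(ℝ, E') ∞ ψ ψ.source :=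
      contMDiffOn_of_mem_maximalAtlas h.codChart_mem_maximalAtlas
    have h2 : ContMDiff 𝓘(ℝ, E') 𝓘(ℝ, E) ∞ (fun z : E' => e.symm (z, (e (φ x)).2)) := by
      rw [contMDiff_iff_contDiff]
      exact e.symm.contDiff.comp (contDiff_id.prodMk contDiff_const)
    exact h2.comp_contMDiffOn h1
  have hτx : τ (f x) = φ x := by
    have := hw (φ x) (φ.map_source hx)
    rw [φ.left_inv hx] at this
    simp only [τ, this]
    exact e.symm_apply_apply _
  refine ⟨ψ.source ∩ τ ⁻¹' φ.target, fun y => φ.symm (τ y),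
    hτs.continuousOn.isOpen_inter_preimage ψ.open_source φ.open_target,
    ⟨hfx, by simpa [hτx] using φ.map_source hx⟩, ?_, ?_, ?_⟩
  · have h3 : ContMDiffOn 𝓘(ℝ, E) 𝓘(ℝ, E) ∞ φ.symm φ.target :=
      contMDiffOn_symm_of_mem_maximalAtlas h.domChart_mem_maximalAtlas
    exact h3.comp (hτs.mono inter_subset_left) fun y hy => hy.2
  · simp only [hτx, φ.left_inv hx]
  · intro y hy
    have h4 := hw (τ y) hy.2
    refine ψ.injOn (h.source_subset_preimage_source (φ.map_target hy.2)) hy.1 ?_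
    rw [h4]
    simp [τ]

theorem Manifold.IsSubmersionAt.mfderiv_surjective {f : M → N} {x : M}
    (hf : Manifold.IsSubmersionAt 𝓘(ℝ, E) 𝓘(ℝ, E') ∞ f x) :
    Function.Surjective (mfderiv 𝓘(ℝ, E) 𝓘(ℝ, E') f x) := by
  obtain ⟨V, σ, hV, hxV, hσ, hσx, hσf⟩ := hf.exists_localSection
  have hσd : HasMFDerivAt 𝓘(ℝ, E') 𝓘(ℝ, E) σ (f x) (mfderiv 𝓘(ℝ, E') 𝓘(ℝ, E) σ (f x)) :=
    ((hσ.contMDiffAt (hV.mem_nhds hxV)).mdifferentiableAt (by simp)).hasMFDerivAt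
  have hfd : HasMFDerivAt 𝓘(ℝ, E) 𝓘(ℝ, E') f (σ (f x)) (mfderiv 𝓘(ℝ, E) 𝓘(ℝ, E') f x) := by
    rw [hσx]
    exact (hf.contMDiffAt.mdifferentiableAt (by simp)).hasMFDerivAt
  have hid : HasMFDerivAt 𝓘(ℝ, E') 𝓘(ℝ, E') (f ∘ σ) (f x)
      (ContinuousLinearMap.id ℝ (TangentSpace 𝓘(ℝ, E') (f x))) := by
    refine (hasMFDerivAt_id (f x)).congr_of_eventuallyEq ?_
    filter_upwards [hV.mem_nhds hxV] with z hz using hσf z hz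
  have := hasMFDerivAt_unique (hfd.comp (f x) hσd) hid
  intro w
  exact ⟨mfderiv 𝓘(ℝ, E') 𝓘(ℝ, E) σ (f x) w, DFunLike.congr_fun this w⟩

end LocalSections

/-! ### Smooth coefficients in a spanning family -/

section Frames

variable {E : Type*} [NormedAddCommGroup E] [NormedSpace ℝ E] [FiniteDimensional ℝ E]
  {M : Type*} [TopologicalSpace M] [ChartedSpace E M] [IsManifold 𝓘(ℝ, E) ∞ M]

/-- If finitely many smooth vector fields span the tangent space at a point, then near this point
there are smooth linear coefficients with respect to these fields. -/
theorem VField.exists_smooth_coefficients {ι : Type*} [Fintype ι] (s : ι → VField E M)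
    (hs : ∀ i, (s i).Smooth) (x₀ : M)
    (hspan : ∀ v : TangentSpace 𝓘(ℝ, E) x₀, ∃ c : ι → ℝ, v = ∑ i, c i • s i x₀) :
    ∃ (V : Set M) (Q : Π x : M, TangentSpace 𝓘(ℝ, E) x →ₗ[ℝ] (ι → ℝ)), IsOpen V ∧ x₀ ∈ V ∧
      ∀ x ∈ V, (∀ v : TangentSpace 𝓘(ℝ, E) x, ∑ i, Q x v i • s i x = v) ∧
        ∀ B : VField E M, ContMDiffAt 𝓘(ℝ, E) 𝓘(ℝ, E).tangent ∞
          (fun x : M => (⟨x, B x⟩ : TangentBundle 𝓘(ℝ, E) M)) x →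
          ∀ i, ContMDiffAt 𝓘(ℝ, E) 𝓘(ℝ, ℝ) ∞ (fun y => Q y (B y) i) x := by
  have : CompleteSpace E := FiniteDimensional.complete ℝ E
  let e := trivializationAt E (TangentSpace 𝓘(ℝ, E) : M → Type _) x₀
  have hx₀ : x₀ ∈ e.baseSet := FiberBundle.mem_baseSet_trivializationAt' x₀
  let u : ι → M → E := fun i y => (e ⟨y, s i y⟩).2
  have hmap : ∀ y ∈ e.baseSet, ∀ v : TangentSpace 𝓘(ℝ, E) y,
      e.continuousLinearMapAt ℝ y v = (e ⟨y, v⟩).2 := fun y hy v =>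
    congrFun (e.coe_linearMapAt_of_mem (R := ℝ) hy) v
  have hu : ∀ i, ∀ y ∈ e.baseSet, ContMDiffAt 𝓘(ℝ, E) 𝓘(ℝ, E) ∞ (u i) y := fun i y hy =>
    (e.contMDiffAt_section_iff hy).1 ((hs i) y)
  -- a right inverse of the coefficient map at the base point
  let P : (ι → ℝ) →ₗ[ℝ] E := ∑ i, (LinearMap.proj i).smulRight (u i x₀)
  have hP : ∀ c, P c = ∑ i, c i • u i x₀ := fun c => by simp [P]
  have hPsurj : Function.Surjective P := by
    intro w
    obtain ⟨c, hc⟩ := hspan (e.symmL ℝ x₀ w)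
    refine ⟨c, ?_⟩
    rw [hP]
    have h1 : e.continuousLinearMapAt ℝ x₀ (e.symmL ℝ x₀ w) = w := by
      exact e.continuousLinearMapAt_symmL hx₀ w
    rw [hc, map_sum] at h1
    rw [← h1]
    refine Finset.sum_congr rfl fun i _ => ?_
    rw [map_smul, hmap x₀ hx₀]
  obtain ⟨R, hR⟩ := P.exists_rightInverse_of_surjective (LinearMap.range_eq_top.2 hPsurj)
  let Rc : ι → E →L[ℝ] ℝ := fun i => LinearMap.toContinuousLinearMap (LinearMap.proj i ∘ₗ R)
  -- `A y` applies the fixed coefficients `R` to the fields at `y`. It is the identity at `x₀`,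
  -- hence invertible nearby, and `R ∘ (A y)⁻¹` gives the coefficients at `y`.
  let A : M → E →L[ℝ] E := fun y => ∑ i, (Rc i).smulRight (u i y)
  have hA : ∀ y ∈ e.baseSet, ContMDiffAt 𝓘(ℝ, E) 𝓘(ℝ, E →L[ℝ] E) ∞ A y := fun y hy => by
    refine ContMDiffAt.sum fun i _ => ?_
    have h1 : ContDiff ℝ ∞ fun w : E => (Rc i).smulRight w := contDiff_const.smulRight contDiff_id
    exact h1.contMDiff.contMDiffAt.comp y (hu i y hy)
  have hA₀ : A x₀ = ContinuousLinearMap.id ℝ E := by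
    ext w
    have := LinearMap.congr_fun hR w
    simpa [A, Rc, hP] using this
  let V : Set M := e.baseSet ∩ A ⁻¹' {T | IsUnit T}
  have hV : IsOpen V :=
    ContinuousOn.isOpen_inter_preimage (fun y hy => (hA y hy).continuousAt.continuousWithinAt)
      e.open_baseSet Units.isOpen
  refine ⟨V, fun y => R ∘ₗ (Ring.inverse (A y)).toLinearMap ∘ₗ
    (e.continuousLinearMapAt ℝ y).toLinearMap, hV, ⟨hx₀, ?_⟩, ?_⟩
  · simp only [mem_preimage, hA₀]
    exact isUnit_one
  rintro y ⟨hy, hyu⟩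
  constructor
  · intro v
    have key : ∀ w, ∑ i, R w i • u i y = A y w := fun w => by simp [A, Rc]
    have hinj : Function.Injective (e.continuousLinearMapAt ℝ y) := by
      rw [← e.coe_continuousLinearEquivAt_eq hy]
      exact (e.continuousLinearEquivAt ℝ y hy).injective
    apply hinj
    rw [map_sum]
    calc ∑ i, e.continuousLinearMapAt ℝ y
          ((R (Ring.inverse (A y) (e.continuousLinearMapAt ℝ y v))) i • s i y)
        = ∑ i, (R (Ring.inverse (A y) (e.continuousLinearMapAt ℝ y v))) i • u i y :=
          Finset.sum_congr rfl fun i _ => by rw [map_smul, hmap y hy (s i y)]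
      _ = (A y * Ring.inverse (A y)) (e.continuousLinearMapAt ℝ y v) := key _
      _ = e.continuousLinearMapAt ℝ y v := by rw [Ring.mul_inverse_cancel _ hyu]; rfl
  · intro B hB i
    have hB' : ContMDiffAt 𝓘(ℝ, E) 𝓘(ℝ, E) ∞ (fun z => (e ⟨z, B z⟩).2) y :=
      (e.contMDiffAt_section_iff hy).1 hB
    have hinv : ContMDiffAt 𝓘(ℝ, E) 𝓘(ℝ, E →L[ℝ] E) ∞ (fun z => Ring.inverse (A z)) y := by
      obtain ⟨U, hU⟩ := hyu
      have h1 : ContDiffAt ℝ ∞ (Ring.inverse : (E →L[ℝ] E) → (E →L[ℝ] E)) (A y) := by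
        rw [← hU]; exact contDiffAt_ringInverse ℝ U
      exact h1.contMDiffAt.comp y (hA y hy)
    have h2 : ContMDiffAt 𝓘(ℝ, E) 𝓘(ℝ, ℝ) ∞
        (fun z => Rc i (Ring.inverse (A z) (e ⟨z, B z⟩).2)) y :=
      (Rc i).contDiff.contMDiff.contMDiffAt.comp y (hinv.clm_apply hB')
    refine h2.congr_of_eventuallyEq ?_
    filter_upwards [e.open_baseSet.mem_nhds hy] with z hz
    simp only [LinearMap.comp_apply, Rc]
    rw [← hmap z hz]
    rfl

end Frames

/-! ### Covariant derivatives that project along a map -/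

section ProjectableConnections

variable {E : Type*} [NormedAddCommGroup E] [NormedSpace ℝ E]
  {M : Type*} [TopologicalSpace M] [ChartedSpace E M] [IsManifold 𝓘(ℝ, E) ∞ M]
  {E' : Type*} [NormedAddCommGroup E'] [NormedSpace ℝ E']
  {N : Type*} [TopologicalSpace N] [ChartedSpace E' N] [IsManifold 𝓘(ℝ, E') ∞ N]

/-- The vector field `X` is differentiable at `x`. -/
abbrev VField.DiffAt (X : VField E M) (x : M) : Prop :=
  MDifferentiableAt 𝓘(ℝ, E) 𝓘(ℝ, E).tangent
    (fun x : M => (⟨x, X x⟩ : TangentBundle 𝓘(ℝ, E) M)) x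

/-- At the point `x`, the map `f` carries the covariant derivative of `B` with respect to `D` to
the covariant derivative of `B'` with respect to `D'`. -/
structure LinearConnection.ProjectsAt (D : LinearConnection E M) (D' : LinearConnection E' N)
    (f : M → N) (x : M) (B : VField E M) (B' : VField E' N) : Prop where
  diffAt : B.DiffAt x
  diffAt' : B'.DiffAt (f x)
  related : mfderiv 𝓘(ℝ, E) 𝓘(ℝ, E') f x (B x) = B' (f x)
  map_deriv : ∀ v : TangentSpace 𝓘(ℝ, E) x, mfderiv 𝓘(ℝ, E) 𝓘(ℝ, E') f x (D B x v) =
    D' B' (f x) (mfderiv 𝓘(ℝ, E) 𝓘(ℝ, E') f x v)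

namespace LinearConnection.ProjectsAt

variable {D : LinearConnection E M} {D' : LinearConnection E' N} {f : M → N} {x : M}
  {B C : VField E M} {B' C' : VField E' N}

theorem congr (h : D.ProjectsAt D' f x B B') (hC : C =ᶠ[𝓝 x] B) (hC' : C' =ᶠ[𝓝 (f x)] B') :
    D.ProjectsAt D' f x C C' := by
  have hCd : C.DiffAt x := h.diffAt.congr_of_eventuallyEq (by
    filter_upwards [hC] with y hy; rw [hy])
  have hCd' : C'.DiffAt (f x) := h.diffAt'.congr_of_eventuallyEq (by
    filter_upwards [hC'] with y hy; rw [hy])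
  refine ⟨hCd, hCd', ?_, fun v => ?_⟩
  · rw [hC.eq_of_nhds, hC'.eq_of_nhds, h.related]
  · rw [D.isCovariantDerivativeOnUniv.congr_of_eventuallyEq hCd h.diffAt univ_mem hC,
      D'.isCovariantDerivativeOnUniv.congr_of_eventuallyEq hCd' h.diffAt' univ_mem hC',
      h.map_deriv]

theorem add (h : D.ProjectsAt D' f x B B') (h' : D.ProjectsAt D' f x C C') :
    D.ProjectsAt D' f x (B + C) (B' + C') where
  diffAt := mdifferentiableAt_add_section h.diffAt h'.diffAt
  diffAt' := mdifferentiableAt_add_section h.diffAt' h'.diffAt'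
  related := by
    simp only [Pi.add_apply, map_add, h.related, h'.related]
  map_deriv v := by
    rw [D.isCovariantDerivativeOnUniv.add h.diffAt h'.diffAt,
      D'.isCovariantDerivativeOnUniv.add h.diffAt' h'.diffAt',
      add_apply, add_apply, map_add, h.map_deriv,
      h'.map_deriv]

theorem zero : D.ProjectsAt D' f x 0 0 where
  diffAt := Bundle.mdifferentiableAt_zeroSection ..
  diffAt' := Bundle.mdifferentiableAt_zeroSection ..
  related := by simp
  map_deriv v := by
    rw [D.isCovariantDerivativeOnUniv.zero, D'.isCovariantDerivativeOnUniv.zero]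
    simp

theorem sum {ι : Type*} (s : Finset ι) {B : ι → VField E M} {B' : ι → VField E' N}
    (h : ∀ i ∈ s, D.ProjectsAt D' f x (B i) (B' i)) :
    D.ProjectsAt D' f x (∑ i ∈ s, B i) (∑ i ∈ s, B' i) := by
  classical
  induction s using Finset.induction_on with
  | empty => simpa using zero
  | insert i s hi ih =>
    rw [Finset.sum_insert hi, Finset.sum_insert hi]
    exact (h i (Finset.mem_insert_self i s)).add
      (ih fun j hj => h j (Finset.mem_insert_of_mem hj))

theorem smul_comp (h : D.ProjectsAt D' f x B B')
    (hf : MDifferentiableAt 𝓘(ℝ, E) 𝓘(ℝ, E') f x) {c : N → ℝ}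
    (hc : MDifferentiableAt 𝓘(ℝ, E') 𝓘(ℝ, ℝ) c (f x)) :
    D.ProjectsAt D' f x ((fun y => c (f y)) • B) (c • B') where
  diffAt := (hc.comp x hf).smul_section h.diffAt
  diffAt' := hc.smul_section h.diffAt'
  related := by
    simp only [Pi.smul_apply', map_smul, h.related]
  map_deriv v := by
    have hcf : MDifferentiableAt 𝓘(ℝ, E) 𝓘(ℝ, ℝ) (fun y => c (f y)) x := hc.comp x hf
    have h1 : mvfderiv 𝓘(ℝ, E) (fun y => c (f y)) x v =
        mvfderiv 𝓘(ℝ, E') c (f x) (mfderiv 𝓘(ℝ, E) 𝓘(ℝ, E') f x v) := by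
      have h2 := mfderiv_comp x hc hf
      simp only [mvfderiv]
      erw [h2]
      rfl
    rw [D.isCovariantDerivativeOnUniv.leibniz h.diffAt hcf,
      D'.isCovariantDerivativeOnUniv.leibniz h.diffAt' hc]
    simp only [add_apply, smul_apply, map_add, map_smul,
      ContinuousLinearMap.smulRight_apply, h.map_deriv, h.related, h1]

/-- Here `b` need not come from the base: the Leibniz term is a multiple of `B x`, which `f` kills,
and the derivative of `B` is killed because that of the zero field vanishes. -/
theorem smul_of_zero (h : D.ProjectsAt D' f x B 0) {b : M → ℝ}
    (hb : MDifferentiableAt 𝓘(ℝ, E) 𝓘(ℝ, ℝ) b x) : D.ProjectsAt D' f x (b • B) 0 where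
  diffAt := hb.smul_section h.diffAt
  diffAt' := h.diffAt'
  related := by
    have := h.related
    simp only [Pi.smul_apply', map_smul, this, Pi.zero_apply, smul_zero]
  map_deriv v := by
    have h0 := h.map_deriv v
    rw [D'.isCovariantDerivativeOnUniv.zero] at h0 ⊢
    rw [D.isCovariantDerivativeOnUniv.leibniz h.diffAt hb]
    simp only [add_apply, smul_apply, map_add, map_smul,
      ContinuousLinearMap.smulRight_apply, h.related, h0]
    simp

end LinearConnection.ProjectsAt

theorem VField.SmoothOn.contMDiffAt {X : VField E M} {U : Set M} (hX : X.SmoothOn U)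
    (hU : IsOpen U) {x : M} (hx : x ∈ U) :
    ContMDiffAt 𝓘(ℝ, E) 𝓘(ℝ, E).tangent ∞
      (fun x : M => (⟨x, X x⟩ : TangentBundle 𝓘(ℝ, E) M)) x :=
  ContMDiffOn.contMDiffAt hX (hU.mem_nhds hx)

variable [FiniteDimensional ℝ E] [FiniteDimensional ℝ E']

/-- If the covariant derivatives of the members of a spanning family of `f`-related vector fields
project along `f`, then so do those of all pairs of `f`-related vector fields. -/
theorem LinearConnection.projectsAt_of_span {ι : Type*} [Fintype ι] {D : LinearConnection E M}
    {D' : LinearConnection E' N} {f : M → N} {x : M} (hf : ContMDiff 𝓘(ℝ, E) 𝓘(ℝ, E') ∞ f)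
    (hfs : Function.Surjective (mfderiv 𝓘(ℝ, E) 𝓘(ℝ, E') f x))
    {s : ι → VField E M} {s' : ι → VField E' N}
    (hs : ∀ i, (s i).Smooth) (hs' : ∀ i, (s' i).Smooth)
    (hspan : ∀ v : TangentSpace 𝓘(ℝ, E) x, ∃ c : ι → ℝ, v = ∑ i, c i • s i x)
    (hrel : ∀ i, VField.Related f (s i) (s' i))
    (hproj : ∀ i, D.ProjectsAt D' f x (s i) (s' i))
    {B : VField E M} {B' : VField E' N} {U : Set M} {U' : Set N} (hU : IsOpen U) (hx : x ∈ U)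
    (hU' : IsOpen U') (hx' : f x ∈ U') (hB : B.SmoothOn U) (hB' : B'.SmoothOn U')
    (hBB' : VField.RelatedOn f B B' U) :
    D.ProjectsAt D' f x B B' := by
  have hfx : MDifferentiableAt 𝓘(ℝ, E) 𝓘(ℝ, E') f x := hf.mdifferentiableAt (by simp)
  have hspan' : ∀ w : TangentSpace 𝓘(ℝ, E') (f x), ∃ c : ι → ℝ, w = ∑ i, c i • s' i (f x) := by
    intro w
    obtain ⟨v, rfl⟩ := hfs w
    obtain ⟨c, hc⟩ := hspan v
    refine ⟨c, ?_⟩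
    rw [hc, map_sum]
    exact Finset.sum_congr rfl fun i _ => by rw [map_smul, hrel i x]
  obtain ⟨V, Q, hV, hxV, hQ⟩ := VField.exists_smooth_coefficients s hs x hspan
  obtain ⟨V', Q', hV', hxV', hQ'⟩ := VField.exists_smooth_coefficients s' hs' (f x) hspan'
  -- Minus the coefficients of `s' j` in the family `s'`, so that `s j + ∑ i, (q i j ∘ f) • s i`
  -- projects to `s' j - s' j = 0` even if `s'` is linearly dependent.
  let q : ι → ι → N → ℝ := fun i j y => -Q' y (s' j y) i
  have hq : ∀ i j, MDifferentiableAt 𝓘(ℝ, E') 𝓘(ℝ, ℝ) (q i j) (f x) := fun i j =>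
    (((hQ' _ hxV').2 (s' j) (hs' j (f x)) i).mdifferentiableAt (by simp)).neg
  let b : ι → M → ℝ := fun j y => Q y (B y) j
  have hb : ∀ j, MDifferentiableAt 𝓘(ℝ, E) 𝓘(ℝ, ℝ) (b j) x := fun j =>
    ((hQ x hxV).2 B (hB.contMDiffAt hU hx) j).mdifferentiableAt (by simp)
  let β : ι → N → ℝ := fun i y => Q' y (B' y) i
  have hβ : ∀ i, MDifferentiableAt 𝓘(ℝ, E') 𝓘(ℝ, ℝ) (β i) (f x) := fun i =>
    ((hQ' _ hxV').2 B' (hB'.contMDiffAt hU' hx') i).mdifferentiableAt (by simp)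
  -- vertical fields with projectable covariant derivative
  let T : ι → VField E M := fun j => s j + ∑ i, (fun y => q i j (f y)) • s i
  have hT : ∀ j, D.ProjectsAt D' f x (T j) 0 := by
    intro j
    refine ((hproj j).add (.sum Finset.univ fun i _ => (hproj i).smul_comp hfx (hq i j))).congr
      (EventuallyEq.refl _ _) ?_
    filter_upwards [hV'.mem_nhds hxV'] with y hy
    have h1 := (hQ' y hy).1 (s' j y)
    simp only [Pi.add_apply, Finset.sum_apply, Pi.smul_apply', q, neg_smul,
      Finset.sum_neg_distrib, h1, Pi.zero_apply, add_neg_cancel]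
    rfl
  -- Near `x`, `B = ∑ j, b j • T j + ∑ i, (β i ∘ f) • s i`: by linearity of `Q'`, the corrections
  -- contained in the `T j` add up to minus the last sum.
  have hsum := (LinearConnection.ProjectsAt.sum Finset.univ
    fun j _ => (hT j).smul_of_zero (hb j)).add
    (.sum Finset.univ fun i _ => (hproj i).smul_comp hfx (hβ i))
  refine hsum.congr ?_ ?_
  · filter_upwards [hV.mem_nhds hxV, hU.mem_nhds hx,
      hf.continuous.continuousAt.preimage_mem_nhds (hV'.mem_nhds hxV')] with y hy hyU hyV'
    have h1 : ∀ i, ∑ j, b j y * q i j (f y) = - β i (f y) := by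
      intro i
      have h2 : B' (f y) = ∑ j, b j y • s' j (f y) := by
        rw [← hBB' y hyU]
        conv_lhs => rw [← (hQ y hy).1 (B y)]
        rw [map_sum]
        exact Finset.sum_congr rfl fun i _ => by rw [map_smul, hrel i y]
      simp only [β, q]
      rw [h2, map_sum, Finset.sum_apply]
      simp only [map_smul, Pi.smul_apply, smul_eq_mul, mul_neg, Finset.sum_neg_distrib]
    simp only [Pi.add_apply, Finset.sum_apply, Pi.smul_apply', T, smul_add, Finset.sum_add_distrib,
      Finset.smul_sum, smul_smul, Pi.mul_apply]
    rw [Finset.sum_comm]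
    simp only [← Finset.sum_smul, h1, neg_smul, Finset.sum_neg_distrib]
    rw [neg_add_cancel_right]
    exact ((hQ y hy).1 (B y)).symm
  · filter_upwards [hV'.mem_nhds hxV'] with y hy
    simp only [Pi.add_apply, Finset.sum_apply, Pi.smul_apply', Pi.zero_apply,
      Finset.sum_const_zero, zero_add]
    exact ((hQ' y hy).1 (B' y)).symm

end ProjectableConnections

/-! ### Smoothness of pushed-forward fields -/

section PushForward

variable {E : Type*} [NormedAddCommGroup E] [NormedSpace ℝ E]
  {M : Type*} [TopologicalSpace M] [ChartedSpace E M] [IsManifold 𝓘(ℝ, E) ∞ M]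
  {E' : Type*} [NormedAddCommGroup E'] [NormedSpace ℝ E']
  {N : Type*} [TopologicalSpace N] [ChartedSpace E' N] [IsManifold 𝓘(ℝ, E') ∞ N]

theorem VField.SmoothOn.contMDiffAt_tangentMap_comp {X : VField E M} {U : Set M}
    (hX : X.SmoothOn U) (hU : IsOpen U) {f : M → N} (hf : ContMDiffOn 𝓘(ℝ, E) 𝓘(ℝ, E') ∞ f U)
    {g : N → M} {y : N} (hg : ContMDiffAt 𝓘(ℝ, E') 𝓘(ℝ, E) ∞ g y) (hy : g y ∈ U) :
    ContMDiffAt 𝓘(ℝ, E') 𝓘(ℝ, E').tangent ∞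
      (fun z => tangentMap 𝓘(ℝ, E) 𝓘(ℝ, E') f ⟨g z, X (g z)⟩) y := by
  have h1 : ContMDiffOn 𝓘(ℝ, E).tangent 𝓘(ℝ, E').tangent ∞
      (tangentMapWithin 𝓘(ℝ, E) 𝓘(ℝ, E') f U)
      (Bundle.TotalSpace.proj ⁻¹' U : Set (TangentBundle 𝓘(ℝ, E) M)) :=
    hf.contMDiffOn_tangentMapWithin le_rfl hU.uniqueMDiffOn
  have hopen : IsOpen (Bundle.TotalSpace.proj ⁻¹' U : Set (TangentBundle 𝓘(ℝ, E) M)) :=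
    hU.preimage (FiberBundle.continuous_proj E (TangentSpace 𝓘(ℝ, E)))
  have h2 : ContMDiffAt 𝓘(ℝ, E') 𝓘(ℝ, E).tangent ∞
      (fun z => (⟨g z, X (g z)⟩ : TangentBundle 𝓘(ℝ, E) M)) y :=
    ContMDiffAt.comp y (hX.contMDiffAt hU hy) hg
  refine ((h1.contMDiffAt (hopen.mem_nhds hy)).comp y h2).congr_of_eventuallyEq ?_
  filter_upwards [hg.continuousAt.preimage_mem_nhds (hU.mem_nhds hy)] with z hz
  simp only [Function.comp_apply, tangentMap, tangentMapWithin]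
  rw [mfderivWithin_of_isOpen hU hz]

/-- A vector field related to a smooth vector field by a surjective submersion is smooth. -/
theorem VField.Related.smooth {f : M → N} (hf : Manifold.IsSubmersion 𝓘(ℝ, E) 𝓘(ℝ, E') ∞ f)
    (hfs : Function.Surjective f) {X : VField E M} {X' : VField E' N} (hX : X.Smooth)
    (h : VField.Related f X X') : X'.Smooth := by
  intro y
  obtain ⟨x, rfl⟩ := hfs y
  obtain ⟨V, σ, hV, hxV, hσ, -, hσf⟩ := (hf.isSubmersionAt x).exists_localSection
  refine (VField.SmoothOn.contMDiffAt_tangentMap_comp (X := X) (U := univ) hX.contMDiffOn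
    isOpen_univ hf.contMDiff.contMDiffOn (hσ.contMDiffAt (hV.mem_nhds hxV))
    (mem_univ _)).congr_of_eventuallyEq ?_
  filter_upwards [hV.mem_nhds hxV] with z hz
  simp only [tangentMap]
  rw [h (σ z), hσf z hz]

end PushForward

/-! ### Right invariant vector fields -/

section RightInvariantFields

variable {E : Type*} [NormedAddCommGroup E] [NormedSpace ℝ E]
  {G : Type*} [TopologicalSpace G] [ChartedSpace E G] [Group G] [LieGroup 𝓘(ℝ, E) ∞ G]

theorem mdifferentiableAt_mul_right_const (g x : G) :
    MDifferentiableAt 𝓘(ℝ, E) 𝓘(ℝ, E) (fun x : G => x * g) x :=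
  (contMDiff_mul_right (I := 𝓘(ℝ, E)) (n := ∞) (a := g)).mdifferentiableAt (by simp)

/-- The field is the tangent map of multiplication `G × G → G` applied to the smooth section `g ↦ (v
at 1, 0 at g)`. -/
theorem rightInvariantField_smooth (v : GroupLieAlgebra 𝓘(ℝ, E) G) :
    (rightInvariantField v : VField E G).Smooth := by
  let fg : G → TangentBundle 𝓘(ℝ, E) G := fun g => Bundle.TotalSpace.mk' E g 0
  have sfg : ContMDiff 𝓘(ℝ, E) 𝓘(ℝ, E).tangent ∞ fg := Bundle.contMDiff_zeroSection _ _
  let fv : G → TangentBundle 𝓘(ℝ, E) G := fun _ => Bundle.TotalSpace.mk' E 1 v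
  have sfv : ContMDiff 𝓘(ℝ, E) 𝓘(ℝ, E).tangent ∞ fv := contMDiff_const
  have S₁ := sfv.prodMk sfg
  have S₂ : ContMDiff (𝓘(ℝ, E).tangent.prod 𝓘(ℝ, E).tangent) (𝓘(ℝ, E).prod 𝓘(ℝ, E)).tangent ∞
      (equivTangentBundleProd 𝓘(ℝ, E) G 𝓘(ℝ, E) G).symm := contMDiff_equivTangentBundleProd_symm
  have S₃ : ContMDiff (𝓘(ℝ, E).prod 𝓘(ℝ, E)).tangent 𝓘(ℝ, E).tangent ∞
      (tangentMap (𝓘(ℝ, E).prod 𝓘(ℝ, E)) 𝓘(ℝ, E) (fun p : G × G => p.1 * p.2)) :=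
    (contMDiff_mul 𝓘(ℝ, E) ∞).contMDiff_tangentMap le_rfl
  have S := (S₃.comp S₂).comp S₁
  unfold VField.Smooth
  convert! S with g
  · simp [fg, fv]
  · simp only [Function.comp_apply, tangentMap, fg, fv]
    rw [mfderiv_prod_eq_add_apply ((contMDiff_mul 𝓘(ℝ, E) ∞).mdifferentiableAt (by simp))]
    simp +instances [rightInvariantField]
    exact ((congrArg (_ + ·) (map_zero _)).trans (add_zero _)).symm

theorem related_mul_right_rightInvariantField (v : GroupLieAlgebra 𝓘(ℝ, E) G) (h : G) :
    VField.Related (fun x : G => x * h) (rightInvariantField v : VField E G)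
      (rightInvariantField v) := by
  intro g
  have h1 : HasMFDerivAt 𝓘(ℝ, E) 𝓘(ℝ, E) (fun x : G => x * g) 1
      (mfderiv 𝓘(ℝ, E) 𝓘(ℝ, E) (fun x : G => x * g) 1) :=
    (mdifferentiableAt_mul_right_const g 1).hasMFDerivAt
  have h2 : HasMFDerivAt 𝓘(ℝ, E) 𝓘(ℝ, E) (fun x : G => x * h) (1 * g)
      (mfderiv 𝓘(ℝ, E) 𝓘(ℝ, E) (fun x : G => x * h) g) := by
    rw [one_mul]
    exact (mdifferentiableAt_mul_right_const h g).hasMFDerivAt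
  have h3 : HasMFDerivAt 𝓘(ℝ, E) 𝓘(ℝ, E) ((fun x : G => x * h) ∘ fun x : G => x * g) 1
      (mfderiv 𝓘(ℝ, E) 𝓘(ℝ, E) (fun x : G => x * (g * h)) 1) := by
    have : ((fun x : G => x * h) ∘ fun x : G => x * g) = fun x : G => x * (g * h) := by
      ext x; simp [mul_assoc]
    rw [this]
    exact (mdifferentiableAt_mul_right_const (g * h) 1).hasMFDerivAt
  exact DFunLike.congr_fun (hasMFDerivAt_unique (h2.comp 1 h1) h3) v

theorem exists_rightInvariantField_eq (g : G) (v : TangentSpace 𝓘(ℝ, E) g) :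
    ∃ w : GroupLieAlgebra 𝓘(ℝ, E) G, rightInvariantField w g = v := by
  have h1 : HasMFDerivAt 𝓘(ℝ, E) 𝓘(ℝ, E) (fun x : G => x * g) (g * g⁻¹)
      (mfderiv 𝓘(ℝ, E) 𝓘(ℝ, E) (fun x : G => x * g) 1) := by
    rw [mul_inv_cancel]
    exact (mdifferentiableAt_mul_right_const g 1).hasMFDerivAt
  have h2 := (mdifferentiableAt_mul_right_const (E := E) g⁻¹ g).hasMFDerivAt
  have h3 : HasMFDerivAt 𝓘(ℝ, E) 𝓘(ℝ, E) ((fun x : G => x * g) ∘ fun x : G => x * g⁻¹) g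
      (ContinuousLinearMap.id ℝ (TangentSpace 𝓘(ℝ, E) g)) := by
    have : ((fun x : G => x * g) ∘ fun x : G => x * g⁻¹) = id := by
      ext x; simp
    rw [this]
    exact hasMFDerivAt_id g
  exact ⟨(mfderiv 𝓘(ℝ, E) 𝓘(ℝ, E) (fun x : G => x * g⁻¹) g v : E),
    DFunLike.congr_fun (hasMFDerivAt_unique (h1.comp g h2) h3) v⟩

theorem exists_eq_sum_rightInvariantField {ι : Type*} [Fintype ι]
    (b : Module.Basis ι ℝ (GroupLieAlgebra 𝓘(ℝ, E) G)) (g : G) (v : TangentSpace 𝓘(ℝ, E) g) :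
    ∃ c : ι → ℝ, v = ∑ i, c i • rightInvariantField (b i) g := by
  obtain ⟨w, rfl⟩ := exists_rightInvariantField_eq g v
  refine ⟨b.repr w, ?_⟩
  conv_lhs => rw [← b.sum_repr w]
  simp only [rightInvariantField]
  rw [map_sum]
  exact Finset.sum_congr rfl fun i _ => by rw [map_smul]; rfl

end RightInvariantFields

/-! ### Projection of invariant fields to the quotient -/

section Quotient

variable {E : Type*} [NormedAddCommGroup E] [NormedSpace ℝ E]
  {G : Type*} [TopologicalSpace G] [ChartedSpace E G] [Group G] [LieGroup 𝓘(ℝ, E) ∞ G]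
  {E' : Type*} [NormedAddCommGroup E'] [NormedSpace ℝ E']
  {H : Subgroup G} [ChartedSpace E' (G ⧸ H)]

/-- A vector field invariant under right translations by `H` projects to `G ⧸ H`. -/
theorem related_projectField {X : VField E G}
    (hπ : ∀ g : G, MDifferentiableAt 𝓘(ℝ, E) 𝓘(ℝ, E') (QuotientGroup.mk : G → G ⧸ H) g)
    (hX : ∀ h ∈ H, VField.Related (fun x : G => x * h) X X) :
    VField.Related (QuotientGroup.mk : G → G ⧸ H) X (projectField H X : VField E' (G ⧸ H)) := by
  intro g
  obtain ⟨h, hh⟩ := QuotientGroup.mk_out_eq_mul H g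
  have h1 := (mdifferentiableAt_mul_right_const (E := E) (h : G) g).hasMFDerivAt
  have h2 := (hπ (g * h)).hasMFDerivAt
  have h3 : HasMFDerivAt 𝓘(ℝ, E) 𝓘(ℝ, E')
      ((QuotientGroup.mk : G → G ⧸ H) ∘ fun x : G => x * (h : G)) g
      (mfderiv 𝓘(ℝ, E) 𝓘(ℝ, E') (QuotientGroup.mk : G → G ⧸ H) g) := by
    have : ((QuotientGroup.mk : G → G ⧸ H) ∘ fun x : G => x * (h : G)) = QuotientGroup.mk := by
      ext x
      exact QuotientGroup.mk_mul_of_mem x h.2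
    rw [this]
    exact (hπ g).hasMFDerivAt
  have h4 := DFunLike.congr_fun (hasMFDerivAt_unique (h2.comp g h1) h3) (X g)
  have h5 := hX h h.2 g
  -- Vectors over the chosen representative and over `g * h` have different types; comparing them in
  -- `E'` lets the equality of base points be substituted.
  have h6 : ∀ k : G, k = g * h →
      (mfderiv 𝓘(ℝ, E) 𝓘(ℝ, E') (QuotientGroup.mk : G → G ⧸ H) k (X k) : E') =
        mfderiv 𝓘(ℝ, E) 𝓘(ℝ, E') (QuotientGroup.mk : G → G ⧸ H) g (X g) := by
    rintro k rfl
    rw [← h5]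
    exact h4
  exact (h6 _ hh).symm

/-- Every tangent vector at `g` is a value of a right invariant field, so the defining identity
covers all directions. It can be read at `g` itself, not just at the chosen representative, because
the affine maps `R_h` preserve right invariant fields and hence their covariant derivatives. -/
theorem LinearConnection.IsDeterminedBy.projectsAt_rightInvariantField
    [IsManifold 𝓘(ℝ, E') ∞ (G ⧸ H)] {D : LinearConnection E G} {D' : LinearConnection E' (G ⧸ H)}
    (hD' : D'.IsDeterminedBy D)
    (hπ : Manifold.IsSubmersion 𝓘(ℝ, E) 𝓘(ℝ, E') ∞ (QuotientGroup.mk : G → G ⧸ H))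
    (hR : ∀ h ∈ H, D.IsAffineTransformation (fun x => x * h))
    (w : GroupLieAlgebra 𝓘(ℝ, E) G) (g : G) :
    D.ProjectsAt D' (QuotientGroup.mk : G → G ⧸ H) g (rightInvariantField w)
      (projectField H (rightInvariantField w)) := by
  have hπd : ∀ g : G, MDifferentiableAt 𝓘(ℝ, E) 𝓘(ℝ, E') (QuotientGroup.mk : G → G ⧸ H) g :=
    fun g => hπ.contMDiff.mdifferentiableAt (by simp)
  have hrel : ∀ v : GroupLieAlgebra 𝓘(ℝ, E) G, VField.Related (QuotientGroup.mk : G → G ⧸ H)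
      (rightInvariantField v : VField E G)
      (projectField H (rightInvariantField v) : VField E' (G ⧸ H)) :=
    fun v => related_projectField hπd fun h _ => related_mul_right_rightInvariantField v h
  have hs := rightInvariantField_smooth w
  refine ⟨hs.mdifferentiable (by simp) g,
    ((hrel w).smooth hπ QuotientGroup.mk_surjective hs).mdifferentiable (by simp) _,
    hrel w g, fun u => ?_⟩
  obtain ⟨v, rfl⟩ := exists_rightInvariantField_eq g u
  have h1 : VField.Related (QuotientGroup.mk : G → G ⧸ H)
      (D.nabla (rightInvariantField v) (rightInvariantField w))
      (projectField H (D.nabla (rightInvariantField v) (rightInvariantField w)) :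
        VField E' (G ⧸ H)) := by
    refine related_projectField (E' := E') hπd fun h hh => ?_
    have hv := rightInvariantField_smooth v
    exact (hR h hh).2 _ _ _ _ hv hs hv hs (related_mul_right_rightInvariantField v h)
      (related_mul_right_rightInvariantField w h)
  have h2 := h1 g
  rw [← hD' v w] at h2
  rw [hrel v g]
  exact h2

end Quotient

/-! ### Local diffeomorphisms, their descent and pushforwards -/

section LocalDiffeomorphisms

variable {E : Type*} [NormedAddCommGroup E] [NormedSpace ℝ E]
  {M : Type*} [TopologicalSpace M] [ChartedSpace E M]
  {E' : Type*} [NormedAddCommGroup E'] [NormedSpace ℝ E']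
  {N : Type*} [TopologicalSpace N] [ChartedSpace E' N]

/-- Every point of `U` has an open neighbourhood of its image on which `f` has a smooth inverse
with values in `U`. -/
theorem IsLocalDiffeomorphOn.exists_localInverse {f : M → N} {U : Set M}
    (hf : IsLocalDiffeomorphOn 𝓘(ℝ, E) 𝓘(ℝ, E') ∞ f U) (hU : IsOpen U) {x : M} (hx : x ∈ U) :
    ∃ (W : Set N) (θ : N → M), IsOpen W ∧ f x ∈ W ∧ ContMDiffOn 𝓘(ℝ, E') 𝓘(ℝ, E) ∞ θ W ∧
      θ (f x) = x ∧ ∀ y ∈ W, θ y ∈ U ∧ f (θ y) = y := by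
  have h := hf ⟨x, hx⟩
  have h1 : h.localInverse (f x) = x := h.localInverse_left_inv h.localInverse_mem_target
  refine ⟨h.localInverse.source ∩ h.localInverse ⁻¹' U, h.localInverse,
    h.localInverse_contMDiffOn.continuousOn.isOpen_inter_preimage h.localInverse_open_source hU,
    ⟨h.localInverse_mem_source, ?_⟩, h.localInverse_contMDiffOn.mono inter_subset_left, h1,
    fun y hy => ⟨hy.2, h.localInverse_right_inv hy.1⟩⟩
  rw [mem_preimage, h1]
  exact hx

theorem IsLocalDiffeomorphOn.isOpen_image {f : M → N} {U : Set M}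
    (hf : IsLocalDiffeomorphOn 𝓘(ℝ, E) 𝓘(ℝ, E') ∞ f U) (hU : IsOpen U) : IsOpen (f '' U) := by
  rw [isOpen_iff_mem_nhds]
  rintro _ ⟨x, hx, rfl⟩
  obtain ⟨W, θ, hW, hxW, -, -, hθ⟩ := hf.exists_localInverse hU hx
  exact mem_of_superset (hW.mem_nhds hxW) fun y hy => ⟨θ y, hθ y hy⟩

theorem IsLocalDiffeomorphOn.mono {f : M → N} {U V : Set M}
    (hf : IsLocalDiffeomorphOn 𝓘(ℝ, E) 𝓘(ℝ, E') ∞ f U) (hV : V ⊆ U) :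
    IsLocalDiffeomorphOn 𝓘(ℝ, E) 𝓘(ℝ, E') ∞ f V :=
  fun x => hf ⟨x, hV x.2⟩

/-- Smooth maps between open sets that are inverse to each other where this makes sense are local
diffeomorphisms. -/
theorem isLocalDiffeomorphAt_of_inverse {f : M → N} {g : N → M} {V : Set M} {W : Set N}
    (hV : IsOpen V) (hW : IsOpen W) (hf : ContMDiffOn 𝓘(ℝ, E) 𝓘(ℝ, E') ∞ f V)
    (hg : ContMDiffOn 𝓘(ℝ, E') 𝓘(ℝ, E) ∞ g W) (hgf : ∀ x ∈ V, f x ∈ W → g (f x) = x)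
    (hfg : ∀ y ∈ W, g y ∈ V → f (g y) = y) {x : M} (hx : x ∈ V) (hfx : f x ∈ W) :
    IsLocalDiffeomorphAt 𝓘(ℝ, E) 𝓘(ℝ, E') ∞ f x := by
  refine ⟨{ toFun := f, invFun := g, source := V ∩ f ⁻¹' W, target := W ∩ g ⁻¹' V,
            map_source' := ?_, map_target' := ?_, left_inv' := ?_, right_inv' := ?_,
            open_source := hf.continuousOn.isOpen_inter_preimage hV hW
            open_target := hg.continuousOn.isOpen_inter_preimage hW hV
            contMDiffOn_toFun := hf.mono inter_subset_left
            contMDiffOn_invFun := hg.mono inter_subset_left }, ⟨hx, hfx⟩, fun _ _ => rfl⟩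
  · rintro z ⟨hz, hfz⟩
    exact ⟨hfz, by rwa [mem_preimage, hgf z hz hfz]⟩
  · rintro z ⟨hz, hgz⟩
    exact ⟨hgz, by rwa [mem_preimage, hfg z hz hgz]⟩
  · rintro z ⟨hz, hfz⟩
    exact hgf z hz hfz
  · rintro z ⟨hz, hgz⟩
    exact hfg z hz hgz

/-- A local diffeomorphism that respects the fibres of a submersion projects to a local
diffeomorphism of the base. -/
theorem isLocalDiffeomorphOn_project {π : M → N} {f : M → M} {U : Set M} {V : Set N} {σ : N → M}
    (hπ : Manifold.IsSubmersion 𝓘(ℝ, E) 𝓘(ℝ, E') ∞ π)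
    (hU : IsOpen U) (hf : IsLocalDiffeomorphOn 𝓘(ℝ, E) 𝓘(ℝ, E) ∞ f U)
    (hfib : ∀ u ∈ U, ∀ u' ∈ U, π u = π u' ↔ π (f u) = π (f u'))
    (hV : IsOpen V) (hσ : ContMDiffOn 𝓘(ℝ, E') 𝓘(ℝ, E) ∞ σ V) (hσU : ∀ q ∈ V, σ q ∈ U)
    (hσπ : ∀ q ∈ V, π (σ q) = q) :
    IsLocalDiffeomorphOn 𝓘(ℝ, E') 𝓘(ℝ, E') ∞ (fun q => π (f (σ q))) V := by
  rintro ⟨q, hq⟩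
  obtain ⟨W, θ, hW, hqW, hθs, -, hθ⟩ := hf.exists_localInverse hU (hσU q hq)
  obtain ⟨V', σ', hV', hqV', hσ's, hσ'q, hσ'⟩ :=
    (hπ.isSubmersionAt (f (σ q))).exists_localSection
  have hO : IsOpen (V' ∩ σ' ⁻¹' W) := hσ's.continuousOn.isOpen_inter_preimage hV' hW
  -- The inverse lifts by `σ'`, undoes `f` by `θ` and projects. The lifts agree with the original
  -- points only up to fibres, which suffices: each direction of `hfib` yields one of the two
  -- inverse identities.
  refine isLocalDiffeomorphAt_of_inverse (f := fun q => π (f (σ q)))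
    (g := fun y => π (θ (σ' y))) hV hO
    (hπ.contMDiff.comp_contMDiffOn (hf.contMDiffOn.comp hσ hσU))
    (hπ.contMDiff.comp_contMDiffOn (hθs.comp (hσ's.mono inter_subset_left) fun y hy => hy.2))
    ?_ ?_ hq ⟨hqV', (congrArg (· ∈ W) hσ'q).mpr hqW⟩
  · rintro x hx ⟨hx1, hx2⟩
    have h1 := hθ _ hx2
    have h2 : π (f (θ (σ' (π (f (σ x)))))) = π (f (σ x)) := by rw [h1.2, hσ' _ hx1]
    exact ((hfib _ h1.1 _ (hσU x hx)).2 h2).trans (hσπ x hx)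
  · rintro y ⟨hy1, hy2⟩ hy3
    have h1 := hθ _ hy2
    have h2 := (hfib _ (hσU _ hy3) _ h1.1).1 (hσπ _ hy3)
    rw [h1.2, hσ' _ hy1] at h2
    exact h2

/-- A smooth vector field can be pushed forward by an injective local diffeomorphism. -/
theorem VField.SmoothOn.exists_pushforward [IsManifold 𝓘(ℝ, E) ∞ M] [IsManifold 𝓘(ℝ, E') ∞ N]
    {Z : VField E M} {U : Set M} (hZ : Z.SmoothOn U) (hU : IsOpen U) {f : M → N}
    (hf : IsLocalDiffeomorphOn 𝓘(ℝ, E) 𝓘(ℝ, E') ∞ f U) (hinj : InjOn f U) :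
    ∃ W : VField E' N, W.SmoothOn (f '' U) ∧ VField.RelatedOn f Z W U := by
  rcases U.eq_empty_or_nonempty with rfl | ⟨x₀, hx₀⟩
  · exact ⟨0, by simp [VField.SmoothOn], fun p hp => hp.elim⟩
  have : Nonempty M := ⟨x₀⟩
  let r : N → M := Function.invFunOn f U
  have hr : ∀ u ∈ U, r (f u) = u := hinj.leftInvOn_invFunOn
  let W : VField E' N := fun y => (mfderiv 𝓘(ℝ, E) 𝓘(ℝ, E') f (r y) (Z (r y)) : E')
  have hW : VField.RelatedOn f Z W U := fun u hu => by
    have h1 : ∀ v, v = u → (mfderiv 𝓘(ℝ, E) 𝓘(ℝ, E') f u (Z u) : E') =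
        mfderiv 𝓘(ℝ, E) 𝓘(ℝ, E') f v (Z v) := by
      rintro v rfl; rfl
    exact h1 _ (hr u hu)
  refine ⟨W, ?_, hW⟩
  rintro _ ⟨u, hu, rfl⟩
  obtain ⟨O, θ, hO, huO, hθs, hθu, hθ⟩ := hf.exists_localInverse hU hu
  refine ContMDiffAt.contMDiffWithinAt ?_
  -- The chosen inverse `r` carries no smoothness; near `f u` the field is recomputed through the
  -- smooth local inverse `θ`.
  refine (hZ.contMDiffAt_tangentMap_comp hU hf.contMDiffOn (hθs.contMDiffAt (hO.mem_nhds huO))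
    (hθ _ huO).1).congr_of_eventuallyEq ?_
  filter_upwards [hO.mem_nhds huO] with z hz
  simp only [tangentMap]
  rw [hW _ (hθ z hz).1, (hθ z hz).2]

end LocalDiffeomorphisms

/-! ### Descent of local affine transformations -/

section ProjectingAffineMaps

variable {E : Type*} [NormedAddCommGroup E] [NormedSpace ℝ E]
  {M : Type*} [TopologicalSpace M] [ChartedSpace E M] [IsManifold 𝓘(ℝ, E) ∞ M]
  {E' : Type*} [NormedAddCommGroup E'] [NormedSpace ℝ E']
  {N : Type*} [TopologicalSpace N] [ChartedSpace E' N] [IsManifold 𝓘(ℝ, E') ∞ N]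

/-- `D` projects to `D'` along the submersion `π`: smooth vector fields on the base lift locally,
and covariant derivatives of `π`-related fields are `π`-related. -/
structure LinearConnection.Projects (D : LinearConnection E M) (D' : LinearConnection E' N)
    (π : M → N) : Prop where
  isSubmersion : Manifold.IsSubmersion 𝓘(ℝ, E) 𝓘(ℝ, E') ∞ π
  exists_lift : ∀ (Z : VField E' N) (V : Set N), IsOpen V → Z.SmoothOn V → ∀ x, π x ∈ V →
    ∃ (O : Set M) (Y : VField E M), IsOpen O ∧ x ∈ O ∧ (∀ u ∈ O, π u ∈ V) ∧ Y.SmoothOn O ∧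
      VField.RelatedOn π Y Z O
  projectsAt : ∀ (B : VField E M) (B' : VField E' N) (U : Set M) (U' : Set N) (x : M),
    IsOpen U → x ∈ U → IsOpen U' → π x ∈ U' → B.SmoothOn U → B'.SmoothOn U' →
    VField.RelatedOn π B B' U → D.ProjectsAt D' π x B B'

theorem LinearConnection.projects_of_span [FiniteDimensional ℝ E] [FiniteDimensional ℝ E']
    {ι : Type*} [Fintype ι] {D : LinearConnection E M} {D' : LinearConnection E' N} {π : M → N}
    (hπ : Manifold.IsSubmersion 𝓘(ℝ, E) 𝓘(ℝ, E') ∞ π)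
    {s : ι → VField E M} {s' : ι → VField E' N}
    (hs : ∀ i, (s i).Smooth) (hs' : ∀ i, (s' i).Smooth)
    (hspan : ∀ (x : M) (v : TangentSpace 𝓘(ℝ, E) x), ∃ c : ι → ℝ, v = ∑ i, c i • s i x)
    (hrel : ∀ i, VField.Related π (s i) (s' i))
    (hproj : ∀ i x, D.ProjectsAt D' π x (s i) (s' i)) : D.Projects D' π where
  isSubmersion := hπ
  projectsAt B B' U U' x hU hx hU' hx' hB hB' hBB' :=
    LinearConnection.projectsAt_of_span hπ.contMDiff (hπ.isSubmersionAt x).mfderiv_surjective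
      hs hs' (hspan x) hrel (fun i => hproj i x) hU hx hU' hx' hB hB' hBB'
  exists_lift Z V hV hZ x hx := by
    have hspan' : ∀ w : TangentSpace 𝓘(ℝ, E') (π x), ∃ c : ι → ℝ, w = ∑ i, c i • s' i (π x) := by
      intro w
      obtain ⟨v, rfl⟩ := (hπ.isSubmersionAt x).mfderiv_surjective w
      obtain ⟨c, hc⟩ := hspan x v
      refine ⟨c, ?_⟩
      rw [hc, map_sum]
      exact Finset.sum_congr rfl fun i _ => by rw [map_smul, hrel i x]
    obtain ⟨V', Q', hV', hxV', hQ'⟩ := VField.exists_smooth_coefficients s' hs' (π x) hspan'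
    -- The lift uses the coefficients of `Z` in the family `s'`, pulled back to `M`, on the fields
    -- `s i`.
    refine ⟨π ⁻¹' (V ∩ V'), fun y => ∑ i, Q' (π y) (Z (π y)) i • s i y,
      (hV.inter hV').preimage hπ.contMDiff.continuous, ⟨hx, hxV'⟩, fun u hu => hu.1, ?_, ?_⟩
    · rintro y ⟨hy, hy'⟩
      refine ContMDiffAt.contMDiffWithinAt ?_
      refine ContMDiffAt.sum_section fun i _ => ?_
      refine ContMDiffAt.smul_section ?_ (hs i y)
      exact ((hQ' _ hy').2 Z (hZ.contMDiffAt hV hy) i).comp y hπ.contMDiff.contMDiffAt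
    · rintro y ⟨hy, hy'⟩
      rw [map_sum]
      conv_rhs => rw [← (hQ' _ hy').1 (Z (π y))]
      exact Finset.sum_congr rfl fun i _ => by rw [map_smul, hrel i y]

variable {D : LinearConnection E M} {D' : LinearConnection E' N} {π : M → N}
  {f : M → M} {U : Set M} {V : Set N} {σ : N → M}

/-- A local affine transformation that respects the fibres of `π` projects to a local affine
transformation of the base. -/
theorem LinearConnection.Projects.isLocalAffineTransformation (hD : D.Projects D' π)
    (hU : IsOpen U) (hf : D.IsLocalAffineTransformation f U)
    (hfib : ∀ u ∈ U, ∀ u' ∈ U, π u = π u' ↔ π (f u) = π (f u'))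
    (hV : IsOpen V) (hσ : ContMDiffOn 𝓘(ℝ, E') 𝓘(ℝ, E) ∞ σ V) (hσU : ∀ q ∈ V, σ q ∈ U)
    (hσπ : ∀ q ∈ V, π (σ q) = q) :
    D'.IsLocalAffineTransformation (fun q => π (f (σ q))) V := by
  obtain ⟨hfd, hfi, hfa⟩ := hf
  have hπ := hD.isSubmersion
  have hπd : ∀ x, HasMFDerivAt 𝓘(ℝ, E) 𝓘(ℝ, E') π x (mfderiv 𝓘(ℝ, E) 𝓘(ℝ, E') π x) := fun x =>
    (hπ.contMDiff.mdifferentiableAt (by simp)).hasMFDerivAt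
  have hψd := isLocalDiffeomorphOn_project hπ hU hfd hfib hV hσ hσU hσπ
  refine ⟨hψd, fun q hq q' hq' h => ?_, ?_⟩
  · rw [← hσπ q hq, ← hσπ q' hq']
    exact (hfib _ (hσU q hq) _ (hσU q' hq')).2 h
  intro V₁ hV₁ hV₁o Y Z Y' Z' hY hZ hY' hZ' hYY' hZZ'
  set ψ : N → N := fun q => π (f (σ q))
  -- Fibre preservation makes `ψ ∘ π = π ∘ f` hold on an open set, not only on the image of `σ`, so
  -- it can be differentiated in all directions.
  have hcomm : ∀ u ∈ U, π u ∈ V → ψ (π u) = π (f u) := fun u hu hu' =>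
    (hfib _ (hσU _ hu') _ hu).1 (hσπ _ hu')
  have hchain : ∀ u ∈ U, π u ∈ V → ∀ v : TangentSpace 𝓘(ℝ, E) u,
      (mfderiv 𝓘(ℝ, E) 𝓘(ℝ, E') π (f u) (mfderiv 𝓘(ℝ, E) 𝓘(ℝ, E) f u v) : E') =
        mfderiv 𝓘(ℝ, E') 𝓘(ℝ, E') ψ (π u) (mfderiv 𝓘(ℝ, E) 𝓘(ℝ, E') π u v) := by
    intro u hu hu' v
    have h1 := (hπd (f u)).comp u ((hfd ⟨u, hu⟩).mdifferentiableAt (by simp)).hasMFDerivAt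
    have h2 := (((hψd ⟨π u, hu'⟩).mdifferentiableAt (by simp)).hasMFDerivAt.comp u (hπd u))
    have h3 := h2.congr_of_eventuallyEq (f₁ := π ∘ f) (by
      filter_upwards [hU.mem_nhds hu,
        (hV.preimage hπ.contMDiff.continuous).mem_nhds hu'] with z hz hz'
      exact (hcomm z hz hz').symm)
    exact DFunLike.congr_fun (hasMFDerivAt_unique h1 h3) v
  have hcast : ∀ (X : VField E' N) (z z' : N), z = z' → (X z : E') = X z' := by
    rintro X z _ rfl; rfl
  have hpush : ∀ (O : Set M) (A W : VField E M) (B B' : VField E' N), O ⊆ U →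
      (∀ u ∈ O, π u ∈ V₁) → VField.RelatedOn π A B O → VField.RelatedOn f A W O →
      VField.RelatedOn ψ B B' V₁ → VField.RelatedOn π W B' (f '' O) := by
    rintro O A W B B' hOU hOV hAB hAW hBB' _ ⟨u, hu, rfl⟩
    have h1 := hchain u (hOU hu) (hV₁ (hOV u hu)) (A u)
    rw [hAW u hu, hAB u hu] at h1
    exact h1.trans ((hBB' _ (hOV u hu)).trans
      (hcast B' _ _ (hcomm u (hOU hu) (hV₁ (hOV u hu)))))
  have main : ∀ g ∈ U, π g ∈ V₁ →
      mfderiv 𝓘(ℝ, E') 𝓘(ℝ, E') ψ (π g) (D'.nabla Y Z (π g)) = D'.nabla Y' Z' (ψ (π g)) := by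
    intro g hgU hgV
    obtain ⟨O₁, A₁, hO₁, hgO₁, hO₁V, hA₁, hAY₁⟩ := hD.exists_lift Y V₁ hV₁o hY g hgV
    obtain ⟨O₂, A₂, hO₂, hgO₂, -, hA₂, hAZ₂⟩ := hD.exists_lift Z V₁ hV₁o hZ g hgV
    set O : Set M := U ∩ (O₁ ∩ O₂)
    have hO : IsOpen O := hU.inter (hO₁.inter hO₂)
    have hgO : g ∈ O := ⟨hgU, hgO₁, hgO₂⟩
    have hOU : O ⊆ U := inter_subset_left
    have hOV : ∀ u ∈ O, π u ∈ V₁ := fun u hu => hO₁V u hu.2.1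
    have hA₁O : A₁.SmoothOn O := ContMDiffOn.mono hA₁ fun u hu => hu.2.1
    have hA₂O : A₂.SmoothOn O := ContMDiffOn.mono hA₂ fun u hu => hu.2.2
    have hAY : VField.RelatedOn π A₁ Y O := fun u hu => hAY₁ u hu.2.1
    have hAZ : VField.RelatedOn π A₂ Z O := fun u hu => hAZ₂ u hu.2.2
    have hfO := hfd.mono hOU
    obtain ⟨W₁, hW₁, hAW₁⟩ := hA₁O.exists_pushforward hO hfO (hfi.mono hOU)
    obtain ⟨W₂, hW₂, hAW₂⟩ := hA₂O.exists_pushforward hO hfO (hfi.mono hOU)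
    have hWY := hpush O A₁ W₁ Y Y' hOU hOV hAY hAW₁ hYY'
    have hWZ := hpush O A₂ W₂ Z Z' hOU hOV hAZ hAW₂ hZZ'
    have haff := hfa O hOU hO A₁ A₂ W₁ W₂ hA₁O hA₂O hW₁ hW₂ hAW₁ hAW₂ g hgO
    have hgV' : ψ (π g) = π (f g) := hcomm g hgU (hV₁ hgV)
    have hp₁ := hD.projectsAt A₂ Z O V₁ g hO hgO hV₁o hgV hA₂O hZ hAZ
    have hp₂ := hD.projectsAt W₂ Z' (f '' O) (ψ '' V₁) (f g) (hfO.isOpen_image hO)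
      (mem_image_of_mem f hgO) ((hψd.mono hV₁).isOpen_image hV₁o)
      ⟨π g, hgV, hgV'⟩ hW₂ hZ' hWZ
    -- With `∇`, `∇'` for `D`, `D'`, the chain is `ψ_* ∇'_Y Z = ψ_* π_* ∇_{A₁} A₂ = π_* f_* ∇_{A₁}
    -- A₂ = π_* ∇_{W₁} W₂ = ∇'_{Y'} Z'`.
    have e1 := hp₁.map_deriv (A₁ g)
    rw [hAY g hgO] at e1
    have e2 := hp₂.map_deriv (W₁ (f g))
    rw [hWY (f g) (mem_image_of_mem f hgO)] at e2
    have e3 := hchain g hgU (hV₁ hgV) (D.nabla A₁ A₂ g)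
    rw [haff] at e3
    have e4 : D'.nabla Y Z (π g) =
        mfderiv 𝓘(ℝ, E) 𝓘(ℝ, E') π g (D.nabla A₁ A₂ g) := e1.symm
    rw [e4]
    exact e3.symm.trans (e2.trans (hcast (D'.nabla Y' Z') _ _ hgV').symm)
  intro p hp
  have h1 := main (σ p) (hσU p (hV₁ hp)) (by rwa [hσπ p (hV₁ hp)])
  rwa [hσπ p (hV₁ hp)] at h1

end ProjectingAffineMaps

/-! ### Integral curves and completeness under related fields -/

section IntegralCurves

variable {E : Type*} [NormedAddCommGroup E] [NormedSpace ℝ E]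
  {M : Type*} [TopologicalSpace M] [ChartedSpace E M]
  {E' : Type*} [NormedAddCommGroup E'] [NormedSpace ℝ E']
  {N : Type*} [TopologicalSpace N] [ChartedSpace E' N]

theorem VField.Related.isMIntegralCurveOn {f : M → N} {X : VField E M} {X' : VField E' N}
    (h : VField.Related f X X') (hf : ∀ x, MDifferentiableAt 𝓘(ℝ, E) 𝓘(ℝ, E') f x) {γ : ℝ → M}
    {s : Set ℝ} (hγ : IsMIntegralCurveOn (I := 𝓘(ℝ, E)) γ X s) :
    IsMIntegralCurveOn (I := 𝓘(ℝ, E')) (fun t => f (γ t)) X' s := by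
  intro t ht
  have h1 := (hf (γ t)).hasMFDerivAt.comp_hasMFDerivWithinAt t (hγ t ht)
  have h2 : (mfderiv 𝓘(ℝ, E) 𝓘(ℝ, E') f (γ t)).comp
      ((1 : ℝ →L[ℝ] ℝ).smulRight (X (γ t))) = (1 : ℝ →L[ℝ] ℝ).smulRight (X' (f (γ t))) := by
    ext
    simp [← h (γ t)]
  exact h2 ▸ h1

theorem VField.Related.isComplete {f : M → N} {X : VField E M} {X' : VField E' N}
    (h : VField.Related f X X') (hf : ∀ x, MDifferentiableAt 𝓘(ℝ, E) 𝓘(ℝ, E') f x)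
    (hfs : Function.Surjective f) (hX : X.IsComplete) : X'.IsComplete := by
  intro y
  obtain ⟨x, rfl⟩ := hfs y
  obtain ⟨γ, hγ, hγX⟩ := hX x
  refine ⟨fun t => f (γ t), congrArg f hγ, ?_⟩
  rw [isMIntegralCurve_iff_isMIntegralCurveOn] at hγX ⊢
  exact h.isMIntegralCurveOn hf hγX

end IntegralCurves

/-! ### The connection on the quotient is a projection -/

section DeterminedConnections

variable {E : Type*} [NormedAddCommGroup E] [NormedSpace ℝ E] [FiniteDimensional ℝ E]
  {G : Type*} [TopologicalSpace G] [ChartedSpace E G] [Group G] [LieGroup 𝓘(ℝ, E) ∞ G]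
  {E' : Type*} [NormedAddCommGroup E'] [NormedSpace ℝ E'] [FiniteDimensional ℝ E']
  {H : Subgroup G} [ChartedSpace E' (G ⧸ H)]

theorem LinearConnection.IsDeterminedBy.projects
    [IsManifold 𝓘(ℝ, E') ∞ (G ⧸ H)] {D : LinearConnection E G} {D' : LinearConnection E' (G ⧸ H)}
    (hD' : D'.IsDeterminedBy D)
    (hπ : Manifold.IsSubmersion 𝓘(ℝ, E) 𝓘(ℝ, E') ∞ (QuotientGroup.mk : G → G ⧸ H))
    (hR : ∀ h ∈ H, D.IsAffineTransformation (fun x => x * h)) :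
    D.Projects D' (QuotientGroup.mk : G → G ⧸ H) := by
  let b : Module.Basis (Fin (Module.finrank ℝ E)) ℝ (GroupLieAlgebra 𝓘(ℝ, E) G) :=
    (Module.finBasis ℝ E : Module.Basis _ ℝ E)
  have hproj := fun i => hD'.projectsAt_rightInvariantField hπ hR (b i)
  have hs := fun i => rightInvariantField_smooth (b i)
  have hrel : ∀ i, VField.Related (QuotientGroup.mk : G → G ⧸ H)
      (rightInvariantField (b i) : VField E G)
      (projectField H (rightInvariantField (b i)) : VField E' (G ⧸ H)) :=
    fun i g => (hproj i g).related
  exact LinearConnection.projects_of_span hπ hs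
    (fun i => (hrel i).smooth hπ QuotientGroup.mk_surjective (hs i))
    (exists_eq_sum_rightInvariantField b) hrel hproj

end DeterminedConnections

/-! ### Invariant flows and their descent -/

section FlowsAndTranslations

variable {E : Type*} [NormedAddCommGroup E] [NormedSpace ℝ E]
  {G : Type*} [TopologicalSpace G] [T2Space G] [ChartedSpace E G] [Group G]
  [LieGroup 𝓘(ℝ, E) ∞ G]

/-- The local flow of a vector field invariant under right translation by `h` commutes with this
translation. -/
theorem LinearConnection.IsLocalOneParameterGroup.eq_mul_right {X : VField E G} {U : Set G} {ε : ℝ}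
    {φ : ℝ → G → G} (hφ : LinearConnection.IsLocalOneParameterGroup X U ε φ) (hX : X.Smooth) {h : G}
    (hXh : VField.Related (fun x : G => x * h) X X) {u u' : G} (hu : u ∈ U) (hu' : u' ∈ U)
    {s t : ℝ} (hs : s ∈ Ioo (-ε) ε) (ht : t ∈ Ioo (-ε) ε) (heq : φ s u' = φ s u * h) :
    φ t u' = φ t u * h :=
  -- Invariance makes `t ↦ φ t u * h` an integral curve of `X`; it meets `t ↦ φ t u'` at time `s`,
  -- so uniqueness gives equality throughout the interval.
  isMIntegralCurveOn_Ioo_eqOn_of_contMDiff_boundaryless (γ' := fun t => φ t u * h) hs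
    (ContMDiff.of_le hX (by simp)) (hφ.integralCurve u' hu')
    (hXh.isMIntegralCurveOn (mdifferentiableAt_mul_right_const h) (hφ.integralCurve u hu)) heq ht

/-- Lying in one coset means differing by a right translation in `H`. Such a relation is carried
from time `0` to time `t` and, for the converse, from time `t` back to `0`. -/
theorem LinearConnection.IsLocalOneParameterGroup.mk_eq_mk_iff {X : VField E G} {U : Set G} {ε : ℝ}
    {φ : ℝ → G → G} (hφ : LinearConnection.IsLocalOneParameterGroup X U ε φ) (hX : X.Smooth)
    {H : Subgroup G} (hXH : ∀ h ∈ H, VField.Related (fun x : G => x * h) X X) {u u' : G}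
    (hu : u ∈ U) (hu' : u' ∈ U) {t : ℝ} (ht : t ∈ Ioo (-ε) ε) :
    (u : G ⧸ H) = u' ↔ (φ t u : G ⧸ H) = φ t u' := by
  have h0 : (0 : ℝ) ∈ Ioo (-ε) ε := ⟨neg_lt_zero.2 hφ.pos, hφ.pos⟩
  constructor
  · intro h
    have hmem := QuotientGroup.eq.1 h
    have h1 := hφ.eq_mul_right hX (hXH _ hmem) hu hu' h0 ht (by
      rw [hφ.initial u hu, hφ.initial u' hu', mul_inv_cancel_left])
    rw [h1, QuotientGroup.mk_mul_of_mem _ hmem]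
  · intro h
    have hmem := QuotientGroup.eq.1 h
    have h1 := hφ.eq_mul_right hX (hXH _ hmem) hu hu' ht h0 (by rw [mul_inv_cancel_left])
    rw [hφ.initial u hu, hφ.initial u' hu'] at h1
    rw [h1, QuotientGroup.mk_mul_of_mem _ hmem]

variable {E' : Type*} [NormedAddCommGroup E'] [NormedSpace ℝ E'] {H : Subgroup G}
  [ChartedSpace E' (G ⧸ H)]

/-- The projection of an invariant infinitesimal affine transformation is infinitesimally affine. -/
theorem LinearConnection.Projects.isInfinitesimalAffine
    [IsManifold 𝓘(ℝ, E') ∞ (G ⧸ H)] {D : LinearConnection E G} {D' : LinearConnection E' (G ⧸ H)}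
    (hD : D.Projects D' (QuotientGroup.mk : G → G ⧸ H)) {X : VField E G}
    {X' : VField E' (G ⧸ H)} (hX : D.IsInfinitesimalAffine X)
    (hXH : ∀ h ∈ H, VField.Related (fun x : G => x * h) X X)
    (hXX' : VField.Related (QuotientGroup.mk : G → G ⧸ H) X X') :
    D'.IsInfinitesimalAffine X' := by
  have hπ := hD.isSubmersion
  refine ⟨hXX'.smooth hπ QuotientGroup.mk_surjective hX.1, fun q => ?_⟩
  obtain ⟨g, rfl⟩ := QuotientGroup.mk_surjective q
  obtain ⟨U, ε, φ, hgU, hφ, hφa⟩ := hX.2 g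
  obtain ⟨V, σ, hV, hgV, hσ, hσg, hσπ⟩ := (hπ.isSubmersionAt g).exists_localSection
  have hVU : IsOpen (V ∩ σ ⁻¹' U) := hσ.continuousOn.isOpen_inter_preimage hV hφ.isOpen
  -- The flow on the quotient is that of `X` started on the section and projected, with the same
  -- time bound `ε`.
  refine ⟨V ∩ σ ⁻¹' U, ε, fun t q => (φ t (σ q) : G ⧸ H), ⟨hgV, by rwa [mem_preimage, hσg]⟩,
    ⟨hVU, hφ.pos, ?_, ?_, ?_⟩, ?_⟩
  · refine hπ.contMDiff.comp_contMDiffOn (hφ.smooth.comp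
      (contMDiffOn_fst.prodMk (hσ.comp contMDiffOn_snd fun p hp => hp.2.1)) ?_)
    exact fun p hp => ⟨hp.1, hp.2.2⟩
  · intro p hp
    rw [hφ.initial _ hp.2, hσπ p hp.1]
  · intro p hp
    exact hXX'.isMIntegralCurveOn (fun x => hπ.contMDiff.mdifferentiableAt (by simp))
      (hφ.integralCurve _ hp.2)
  · intro t ht
    exact hD.isLocalAffineTransformation hφ.isOpen (hφa t ht)
      (fun u hu u' hu' => hφ.mk_eq_mk_iff hX.1 hXH hu hu' ht) hVU (hσ.mono inter_subset_left)
      (fun q hq => hq.2) fun q hq => hσπ q hq.1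

end FlowsAndTranslations

end

theorem mainTheorem8
    {E : Type*} [NormedAddCommGroup E] [NormedSpace ℝ E] [FiniteDimensional ℝ E]
    {G : Type*} [TopologicalSpace G] [T2Space G] [ChartedSpace E G] [Group G]
    [LieGroup 𝓘(ℝ, E) ∞ G]
    (D : LinearConnection E G) (hD : D.IsFlatAffineLieGroup)
    (H : Subgroup G) (hH : IsClosed (H : Set G))
    -- the manifold structure of `G/H`: the one for which the projection is a smooth submersion
    {E' : Type*} [NormedAddCommGroup E'] [NormedSpace ℝ E'] [FiniteDimensional ℝ E']
    [ChartedSpace E' (G ⧸ H)] [IsManifold 𝓘(ℝ, E') ∞ (G ⧸ H)]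
    (hπ : Manifold.IsSubmersion 𝓘(ℝ, E) 𝓘(ℝ, E') ∞ (QuotientGroup.mk : G → G ⧸ H))
    (hR : ∀ h ∈ H, D.IsAffineTransformation (fun x => x * h))
    (D' : LinearConnection E' (G ⧸ H)) (hD's : D'.IsSmooth) (hD' : D'.IsDeterminedBy D) :
    ∀ X ∈ D.aff, (∀ h ∈ H, VField.Related (fun x : G => x * h) X X) →
      VField.Related (QuotientGroup.mk : G → G ⧸ H) X (projectField H X : VField E' (G ⧸ H)) ∧
      (projectField H X : VField E' (G ⧸ H)) ∈ D'.aff := by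
  intro X hX hXH
  have hπd : ∀ g : G, MDifferentiableAt 𝓘(ℝ, E) 𝓘(ℝ, E') (QuotientGroup.mk : G → G ⧸ H) g :=
    fun g => hπ.contMDiff.mdifferentiableAt (by simp)
  have hrel : VField.Related (QuotientGroup.mk : G → G ⧸ H) X
      (projectField H X : VField E' (G ⧸ H)) := related_projectField hπd hXH
  exact ⟨hrel, (hD'.projects hπ hR).isInfinitesimalAffine hX.1 hXH hrel,
    hrel.isComplete hπd QuotientGroup.mk_surjective hX.2⟩
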